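/- For integers $n\ge 0$ let $p(n)$ be the number of partitions of $n$, and let $\mathrm{spt}(n)$ be the total number of appearances of the smallest part in all partitions of $n$, that is, $\mathrm{spt}(n)=\sum_{\pi}\nu_{s}(\pi)$, where $\pi$ runs over the partitions of $n$ and $\nu_s(\pi)$ is the multiplicity of the smallest part of $\pi$ (the empty partition contributes $0$). The rank of a partition is its largest part minus its number of parts (the empty partition has rank $0$). Let $N(m,n)$ be the number of partitions of $n$ with rank $m$, and let $N_2(n)=\sum_{m=-\infty}^{\infty}m^2N(m,n)$ be the second Atkin–Garvan rank moment. Then for every integer $n\ge 0$, $$\mathrm{spt}(n)=n\,p(n)-\tfrac12 N_2(n).$$ -/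

import Mathlib

namespace SptRank

/-- The smallest part of a partition (`0` for the empty partition). -/
noncomputable def smallestPart {n : ℕ} (π : n.Partition) : ℕ := sInf {i | i ∈ π.parts}

/-- The largest part of a partition (`0` for the empty partition). -/
def largestPart {n : ℕ} (π : n.Partition) : ℕ := π.parts.sup

/-- Dyson's rank: the largest part minus the number of parts. -/
def rank {n : ℕ} (π : n.Partition) : ℤ := (largestPart π : ℤ) - (π.parts.card : ℤ)

/-- The number `p(n)` of partitions of `n`. -/
def p (n : ℕ) : ℕ := Fintype.card n.Partition

/-- The number `spt(n)` of smallest parts, counted with multiplicity, in all partitions of `n`. -/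
noncomputable def spt (n : ℕ) : ℕ := ∑ π : n.Partition, π.parts.count (smallestPart π)

/-- The number `N(m, n)` of partitions of `n` with rank `m`. -/
def N (m : ℤ) (n : ℕ) : ℕ := Fintype.card {π : n.Partition // rank π = m}

/-- The Atkin–Garvan rank moment `N_k(n) = ∑_{m ∈ ℤ} m ^ k N(m, n)`. Only finitely many terms are
nonzero, see `finite_support_rankMoment`. -/
noncomputable def rankMoment (k n : ℕ) : ℤ := ∑ᶠ m : ℤ, m ^ k * (N m n : ℤ)

theorem finite_support_rankMoment (k n : ℕ) :
    (Function.support fun m : ℤ => m ^ k * (N m n : ℤ)).Finite := by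
  refine (Set.finite_range (fun π : n.Partition => rank π)).subset fun m hm => ?_
  have h : N m n ≠ 0 := fun h0 => hm (by simp [h0])
  obtain ⟨π, hπ⟩ := Fintype.card_pos_iff.mp (Nat.pos_of_ne_zero h)
  exact ⟨π, hπ⟩

end SptRank

/-!
The identity is proved between generating functions in `ℤ⟦X⟧`, with `q = X`. Put
`a_k = q ^ k / (1 - q ^ k) ^ 2`, and let `P i j` be the sum of `q ^ (|π| + i ℓ + j m)` over all
partitions `π`, where `ℓ` is the largest part and `m` the number of parts.

* Double counting gives `∑ n p(n) q ^ n = P 0 0 * ∑ a_k` (`tsum_size`).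
* Splitting off the copies of the smallest part `k`, and subtracting `k` from the other parts, gives
  `∑ spt(n) q ^ n = ∑ a_k * P 0 k` (`tsum_minCount`).
* Removing the largest hook of a Young diagram gives
  `P i j = 1 + q ^ (i + j + 1) / ((1 - q ^ (i + 1)) (1 - q ^ (j + 1))) * P (i + 1) (j + 1)`
  (`partitionSeries_eq`). The rank of the partition is that of the partition inside the hook plus
  the difference of two independent geometric variables, so the second rank moment `M j`, weighted
  by `q ^ (|π| + j ℓ + j m)`, satisfies a similar recursion (`rankSqSeries_eq`).

Iterating the hook recursion (the Durfee square expansion) would turn `∑ n p(n) q ^ n - M 0 / 2` into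
`∑_n q ^ (n ^ 2) / (q)_n ^ 2 * ∑_{k > n} a_k`, and the series of `spt` into
`∑_n q ^ (n ^ 2) / (q)_n ^ 2 * A_n` with
`A_n = ∑_{k ≥ 1} a_k q ^ (n k) (q)_k (q)_n / (q)_{n + k}`. The heart of the matter is that
`A_n = ∑_{k > n} a_k`, because `A_n - A_{n + 1}` telescopes to `a_{n + 1}` (`tsum_durfeeTerm`).
No infinite product or iterated expansion is needed: twice either series is the `u_0` of a recursion
`u_n = 2 A_n + c_n u_{n + 1}`, with the same `A_n` and `c_n` for both and `X ∣ c_n`, so they agree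
(`two_mul_tsum_durfeeTerm`).
-/

namespace SptRank

open Filter Topology PowerSeries
open scoped PowerSeries.WithPiTopology

/-! ### Summation of formal power series -/

theorem tendsto_cofinite_atTop_of_finite_le {α : Type*} {w : α → ℕ}
    (h : ∀ n, {x | w x ≤ n}.Finite) : Tendsto w cofinite atTop := by
  refine tendsto_atTop.2 fun n => ?_
  refine (h n).subset fun x hx => ?_
  simp only [Set.mem_compl_iff, Set.mem_ofPred_eq, not_le] at hx
  exact hx.le

theorem finite_le_of_tendsto {α : Type*} {w : α → ℕ} (h : Tendsto w cofinite atTop) (n : ℕ) :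
    {x | w x ≤ n}.Finite := by
  have := tendsto_atTop.1 h (n + 1)
  refine Set.Finite.subset this fun x hx => ?_
  simp only [Set.mem_ofPred_eq, Set.mem_compl_iff] at hx ⊢
  omega

theorem tendsto_of_le {α : Type*} {v w : α → ℕ} (hv : Tendsto v cofinite atTop)
    (h : ∀ x, v x ≤ w x) : Tendsto w cofinite atTop :=
  tendsto_atTop_mono h hv

theorem tendsto_add_prod {α β : Type*} {v : α → ℕ} {w : β → ℕ} (hv : Tendsto v cofinite atTop)
    (hw : Tendsto w cofinite atTop) :
    Tendsto (fun x : α × β => v x.1 + w x.2) cofinite atTop := by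
  refine tendsto_cofinite_atTop_of_finite_le fun n => ?_
  refine ((finite_le_of_tendsto hv n).prod (finite_le_of_tendsto hw n)).subset ?_
  rintro ⟨x, y⟩ h
  simp only [Set.mem_ofPred_eq, Set.mem_prod] at h ⊢
  omega

theorem tendsto_mul_add_one (k : ℕ) : Tendsto (fun n : ℕ => (k + 1) * n) cofinite atTop := by
  rw [Nat.cofinite_eq_atTop]
  exact tendsto_id.const_mul_atTop' k.succ_pos

theorem tendsto_add_right (k : ℕ) : Tendsto (fun n : ℕ => n + k) cofinite atTop := by
  rw [Nat.cofinite_eq_atTop]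
  exact tendsto_add_atTop_nat k

/-- A family is summable as soon as only finitely many members are nonzero modulo each power of
`X`. -/
theorem summable_of_X_pow_dvd {α : Type*} {w : α → ℕ} (hw : Tendsto w cofinite atTop)
    {f : α → ℤ⟦X⟧} (h : ∀ x, X ^ w x ∣ f x) : Summable f := by
  rw [PowerSeries.WithPiTopology.summable_iff_summable_coeff]
  intro d
  refine summable_of_hasFiniteSupport ((finite_le_of_tendsto hw d).subset fun x hx => ?_)
  by_contra hlt
  exact hx (X_pow_dvd_iff.1 (h x) d (not_le.1 hlt))

theorem hasSum_mul {α β : Type*} {v : α → ℕ} {w : β → ℕ} (hv : Tendsto v cofinite atTop)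
    (hw : Tendsto w cofinite atTop) {f : α → ℤ⟦X⟧} {g : β → ℤ⟦X⟧} (hf : ∀ x, X ^ v x ∣ f x)
    (hg : ∀ x, X ^ w x ∣ g x) :
    HasSum (fun x : α × β => f x.1 * g x.2) ((∑' x, f x) * ∑' x, g x) :=
  (summable_of_X_pow_dvd hv hf).hasSum.mul (summable_of_X_pow_dvd hw hg).hasSum
    (summable_of_X_pow_dvd (tendsto_add_prod hv hw) fun x => by
      rw [pow_add]; exact mul_dvd_mul (hf _) (hg _))

/-- Iterating the recursion shows that `u n` is divisible by every power of `X`. -/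
theorem eq_zero_of_eq_mul_succ {u c : ℕ → ℤ⟦X⟧} (hc : ∀ n, X ∣ c n)
    (h : ∀ n, u n = c n * u (n + 1)) (n : ℕ) : u n = 0 := by
  have key : ∀ r n, X ^ r ∣ u n := by
    intro r
    induction r with
    | zero => simp
    | succ r ih =>
      intro n
      rw [h n, pow_succ']
      exact mul_dvd_mul (hc n) (ih _)
  ext d
  simpa using X_pow_dvd_iff.1 (key (d + 1) n) d d.lt_succ_self

theorem tendsto_zero_of_X_pow_dvd {V : ℕ → ℤ⟦X⟧} (hV : ∀ n, X ^ n ∣ V n) :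
    Tendsto V atTop (𝓝 0) := by
  rw [PowerSeries.WithPiTopology.tendsto_iff_coeff_tendsto]
  intro d
  refine tendsto_const_nhds.congr' ?_
  filter_upwards [eventually_gt_atTop d] with n hn
  simpa using (X_pow_dvd_iff.1 (hV n) d hn).symm

/-- A telescoping series whose potential `V` tends to zero `X`-adically. -/
theorem hasSum_of_telescope {f V : ℕ → ℤ⟦X⟧} (hf : Summable f) (hV : ∀ n, X ^ n ∣ V n)
    (h : ∀ n, f n = V n - V (n + 1)) : HasSum f (V 0) := by
  rw [hf.hasSum_iff_tendsto_nat]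
  simp only [h, Finset.sum_range_sub']
  simpa using tendsto_const_nhds.sub (tendsto_zero_of_X_pow_dvd hV)

/-! ### Geometric series -/

/-- The geometric series `1 / (1 - X ^ (k + 1))`. The shift by one keeps every index admissible. -/
noncomputable def geom (k : ℕ) : ℤ⟦X⟧ := ∑' n : ℕ, X ^ ((k + 1) * n)

/-- The series `X ^ (k + 1) / (1 - X ^ (k + 1)) ^ 2`. -/
noncomputable def lambertTerm (k : ℕ) : ℤ⟦X⟧ := X ^ (k + 1) * geom k ^ 2

theorem summable_mul_X_pow (k : ℕ) (c : ℕ → ℤ⟦X⟧) :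
    Summable fun n : ℕ => c n * X ^ ((k + 1) * n) :=
  summable_of_X_pow_dvd (tendsto_mul_add_one k) fun _ => Dvd.intro_left _ rfl

theorem geom_mul (k : ℕ) : (1 - X ^ (k + 1)) * geom k = 1 := by
  have := PowerSeries.WithPiTopology.one_sub_mul_tsum_pow_of_constantCoeff_eq_zero
    (f := (X : ℤ⟦X⟧) ^ (k + 1)) (by simp)
  simpa only [← pow_mul, geom] using this

theorem tsum_linear_mul_X_pow (k : ℕ) :
    ∑' n : ℕ, (n : ℤ⟦X⟧) * X ^ ((k + 1) * n) = X ^ (k + 1) * geom k ^ 2 := by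
  set s := ∑' n : ℕ, (n : ℤ⟦X⟧) * X ^ ((k + 1) * n) with hs
  have h1 : s = X ^ (k + 1) * s + X ^ (k + 1) * geom k := by
    have hg : Summable fun n : ℕ => (X : ℤ⟦X⟧) ^ ((k + 1) * n) := by
      simpa using summable_mul_X_pow k 1
    have h2 := (summable_mul_X_pow k fun n => (n : ℤ⟦X⟧))
    conv_lhs => rw [hs, h2.tsum_eq_zero_add]
    rw [hs, geom, ← h2.tsum_mul_left, ← hg.tsum_mul_left,
      ← (h2.mul_left _).tsum_add (hg.mul_left _)]
    simp only [Nat.cast_zero, zero_mul, zero_add]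
    refine tsum_congr fun n => ?_
    push_cast; ring
  linear_combination geom k * h1 - s * geom_mul k

theorem tsum_sq_mul_X_pow (k : ℕ) :
    ∑' n : ℕ, (n : ℤ⟦X⟧) ^ 2 * X ^ ((k + 1) * n) =
      X ^ (k + 1) * (1 + X ^ (k + 1)) * geom k ^ 3 := by
  set s := ∑' n : ℕ, (n : ℤ⟦X⟧) ^ 2 * X ^ ((k + 1) * n) with hs
  have h1 : s = X ^ (k + 1) * (s + (2 * (X ^ (k + 1) * geom k ^ 2) + geom k)) := by
    have hg : Summable fun n : ℕ => (X : ℤ⟦X⟧) ^ ((k + 1) * n) := by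
      simpa using summable_mul_X_pow k 1
    have h2 := summable_mul_X_pow k fun n => (n : ℤ⟦X⟧)
    have h3 := summable_mul_X_pow k fun n => (n : ℤ⟦X⟧) ^ 2
    conv_lhs => rw [hs, h3.tsum_eq_zero_add]
    rw [hs, ← tsum_linear_mul_X_pow, geom, ← h2.tsum_mul_left,
      ← (h2.mul_left _).tsum_add hg, ← h3.tsum_add ((h2.mul_left _).add hg),
      ← (h3.add ((h2.mul_left _).add hg)).tsum_mul_left]
    simp only [Nat.cast_zero, ne_eq, OfNat.ofNat_ne_zero, not_false_eq_true, zero_pow, zero_mul,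
      zero_add]
    refine tsum_congr fun n => ?_
    push_cast; ring
  linear_combination geom k * h1 - (s + X ^ (k + 1) * geom k ^ 2) * geom_mul k

theorem tsum_succ_mul_X_pow (k : ℕ) :
    ∑' n : ℕ, ((n : ℤ⟦X⟧) + 1) * X ^ ((k + 1) * (n + 1)) = lambertTerm k := by
  have h := (summable_mul_X_pow k fun n => (n : ℤ⟦X⟧)).tsum_eq_zero_add
  rw [tsum_linear_mul_X_pow] at h
  simpa [lambertTerm] using h.symm

/-! ### A telescoping sum -/

/-- With `(q)_r = (1 - q) ⋯ (1 - q ^ r)` and `q = X`, the series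
`q ^ ((n + 1) (k + 1)) (q)_n (q)_{k+1} / ((1 - q ^ (k + 1)) ^ 2 (q)_{n+k+1})`. -/
noncomputable def durfeeTerm (k : ℕ) : ℕ → ℤ⟦X⟧
  | 0 => lambertTerm k
  | n + 1 => durfeeTerm k n * (X ^ (k + 1) * (1 - X ^ (n + 1)) * geom (n + k + 1))

theorem X_pow_dvd_lambertTerm (k : ℕ) : X ^ (k + 1) ∣ lambertTerm k := Dvd.intro _ rfl

theorem X_pow_dvd_durfeeTerm (k n : ℕ) : X ^ (k + 1) ∣ durfeeTerm k n := by
  induction n with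
  | zero => exact X_pow_dvd_lambertTerm k
  | succ n ih => exact ih.mul_right _

/-- The recursion of `durfeeTerm` in its first index, with the denominators cleared. -/
theorem durfeeTerm_succ_left (k n : ℕ) :
    durfeeTerm (k + 1) n * (1 - X ^ (k + 2)) * (1 - X ^ (n + k + 2)) =
      X ^ (n + 1) * durfeeTerm k n * (1 - X ^ (k + 1)) ^ 2 := by
  induction n with
  | zero =>
    simp only [durfeeTerm, lambertTerm, zero_add, pow_one]
    have h1 := geom_mul k
    have h2 := geom_mul (k + 1)
    have e1 : ((1 - X ^ (k + 1)) * geom k) ^ 2 = 1 := by rw [h1, one_pow]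
    have e2 : ((1 - X ^ (k + 2)) * geom (k + 1)) ^ 2 = 1 := by rw [h2, one_pow]
    linear_combination X ^ (k + 2) * e2 - X ^ (k + 2) * e1
  | succ n ih =>
    simp only [durfeeTerm]
    have h1 := geom_mul (n + k + 1)
    have h2 := geom_mul (n + (k + 1) + 1)
    simp only [show n + (k + 1) + 1 = n + k + 2 by omega, show n + 1 + k + 2 = n + k + 3 by omega,
      show n + k + 1 + 1 = n + k + 2 by omega, show n + k + 2 + 1 = n + k + 3 by omega] at h1 h2 ⊢
    linear_combination
      (X ^ (k + 2) * (1 - X ^ (n + 1)) * durfeeTerm (k + 1) n * (1 - X ^ (k + 2))) * h2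
      - (X ^ (k + 2) * (1 - X ^ (n + 1)) * durfeeTerm (k + 1) n * (1 - X ^ (k + 2))) * h1
      + (X ^ (k + 2) * (1 - X ^ (n + 1)) * geom (n + k + 1)) * ih

theorem durfeeTerm_zero_left (n : ℕ) :
    durfeeTerm 0 n * (1 - X) = X ^ (n + 1) * geom n := by
  induction n with
  | zero =>
    have h := geom_mul 0
    simp only [durfeeTerm, lambertTerm, zero_add, pow_one] at h ⊢
    linear_combination X * geom 0 * h
  | succ n ih =>
    have h := geom_mul n
    simp only [durfeeTerm, zero_add, pow_one, add_zero]
    linear_combination X * (1 - X ^ (n + 1)) * geom (n + 1) * ih + X ^ (n + 2) * geom (n + 1) * h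

theorem summable_durfeeTerm (n : ℕ) : Summable fun k => durfeeTerm k n :=
  summable_of_X_pow_dvd (tendsto_add_right 1) fun k => X_pow_dvd_durfeeTerm k n

theorem summable_lambertTerm (n : ℕ) : Summable fun k => lambertTerm (n + k) :=
  summable_of_X_pow_dvd (tendsto_add_right 1) fun k =>
    (pow_dvd_pow X (by omega)).trans (X_pow_dvd_lambertTerm (n + k))

theorem tsum_durfeeTerm_sub (n : ℕ) :
    ∑' k, durfeeTerm k n - ∑' k, durfeeTerm k (n + 1) = lambertTerm n := by
  rw [← (summable_durfeeTerm n).tsum_sub (summable_durfeeTerm (n + 1))]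
  -- the increments simplify through `(1 - q ^ (n + k + 2)) - q ^ (n + 1) (1 - q ^ (k + 1))`, which is
  -- `1 - q ^ (n + 1)`, with `q = X`
  have h := hasSum_of_telescope
    (V := fun k => durfeeTerm k n * (1 - X ^ (k + 1)) * geom n)
    ((summable_durfeeTerm n).sub (summable_durfeeTerm (n + 1)))
    (fun k => (((pow_dvd_pow X k.le_succ).trans (X_pow_dvd_durfeeTerm k n)).mul_right _).mul_right _)
    (fun k => by
      have h1 := geom_mul n
      have h2 := geom_mul (n + k + 1)
      have h3 := durfeeTerm_succ_left k n
      simp only [durfeeTerm, show n + k + 1 + 1 = n + k + 2 by omega,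
        show k + 1 + 1 = k + 2 by omega] at h2 ⊢
      linear_combination
        (durfeeTerm k n * ((1 - X ^ (k + 1)) * geom n - 1)
          - durfeeTerm (k + 1) n * (1 - X ^ (k + 2)) * geom n) * h2
        + geom n * geom (n + k + 1) * h3
        - durfeeTerm k n * (1 - X ^ (k + 1)) * geom (n + k + 1) * h1)
  rw [h.tsum_eq]
  simp only [zero_add, pow_one, durfeeTerm_zero_left, lambertTerm]
  ring

/-- Every term changes with `n`, but the sum only loses `lambertTerm n` at each step. -/
theorem tsum_durfeeTerm (n : ℕ) : ∑' k, durfeeTerm k n = ∑' k, lambertTerm (n + k) := by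
  induction n with
  | zero => simp [durfeeTerm]
  | succ n ih =>
    have h1 := tsum_durfeeTerm_sub n
    have h2 := (summable_lambertTerm n).tsum_eq_zero_add
    simp only [add_zero] at h2
    have h3 : ∑' k, lambertTerm (n + (k + 1)) = ∑' k, lambertTerm (n + 1 + k) :=
      tsum_congr fun k => by rw [show n + (k + 1) = n + 1 + k by omega]
    rw [← h3]
    linear_combination ih - h1 + h2

/-! ### Multisets of naturals as partitions -/

/-- A multiset `s` of natural numbers encodes the partition whose parts are the `i + 1`, `i ∈ s`, so
that the type of all partitions is `Multiset ℕ`, with no positivity condition. -/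
def parts (s : Multiset ℕ) : Multiset ℕ := s.map (· + 1)

/-- The number partitioned by `parts s`. -/
def size (s : Multiset ℕ) : ℕ := (parts s).sum

/-- The largest part, `0` for the empty partition. -/
def maxPart (s : Multiset ℕ) : ℕ := (parts s).sup

/-- The exponent recording size, largest part and number of parts: the generating function with
these weights is the rank generating function at `x = X ^ i`, `y = X ^ j`, where `x` marks the
largest part and `y` the number of parts. -/
def weight (i j : ℕ) (s : Multiset ℕ) : ℕ := size s + i * maxPart s + j * s.card

@[simp] theorem parts_zero : parts 0 = 0 := rfl
@[simp] theorem size_zero : size 0 = 0 := rfl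
@[simp] theorem maxPart_zero : maxPart 0 = 0 := rfl

theorem size_add (s t : Multiset ℕ) : size (s + t) = size s + size t := by
  simp [size, parts]

theorem size_cons (i : ℕ) (s : Multiset ℕ) : size (i ::ₘ s) = i + 1 + size s := by
  simp [size, parts]

theorem size_replicate (r k : ℕ) : size (Multiset.replicate r k) = r * (k + 1) := by
  simp [size, parts]

theorem size_map_add (k : ℕ) (s : Multiset ℕ) :
    size (s.map (· + k)) = size s + k * s.card := by
  induction s using Multiset.induction with
  | empty => simp
  | cons i s ih => rw [Multiset.map_cons, size_cons, size_cons, ih, Multiset.card_cons]; ring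

theorem parts_injective : Function.Injective parts :=
  Multiset.map_injective (add_left_injective 1)

theorem exists_parts_eq {m : Multiset ℕ} (h : ∀ i ∈ m, 0 < i) : ∃ s, parts s = m := by
  refine ⟨m.map Nat.pred, ?_⟩
  rw [parts, Multiset.map_map]
  conv_rhs => rw [← m.map_id]
  exact Multiset.map_congr rfl fun i hi => Nat.succ_pred_eq_of_pos (h i hi)

theorem tendsto_size : Tendsto size cofinite atTop := by
  refine tendsto_cofinite_atTop_of_finite_le fun n => ?_
  refine (Set.finite_range
    fun π : Σ m : Fin (n + 1), (m : ℕ).Partition => π.2.parts.map Nat.pred).subset fun s hs => ?_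
  refine ⟨⟨⟨size s, Nat.lt_succ_of_le hs⟩, ⟨parts s, ?_, rfl⟩⟩, ?_⟩
  · intro i hi
    obtain ⟨a, -, rfl⟩ := Multiset.mem_map.1 hi
    exact a.succ_pos
  · simp [parts]

theorem tendsto_weight (i j : ℕ) : Tendsto (weight i j) cofinite atTop :=
  tendsto_of_le tendsto_size fun s => by unfold weight; omega

/-- The sum of a function over the partitions of `n`, as a coefficient. -/
theorem coeff_tsum_parts (f : Multiset ℕ → ℤ) (n : ℕ) :
    coeff n (∑' s, (C (f (parts s)) : ℤ⟦X⟧) * X ^ size s) = ∑ π : n.Partition, f π.parts := by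
  have h := ((PowerSeries.WithPiTopology.hasSum_iff_hasSum_coeff ℤ).1
    (summable_of_X_pow_dvd tendsto_size (f := fun s => (C (f (parts s)) : ℤ⟦X⟧) * X ^ size s)
      fun s => dvd_mul_left _ _).hasSum n)
  rw [← h.tsum_eq]
  have hex (π : n.Partition) : ∃ s, parts s = π.parts := exists_parts_eq fun _ hi => π.parts_pos hi
  choose g hg using hex
  have hinj : Function.Injective g := fun π π' h => by
    ext1; rw [← hg, ← hg, h]
  rw [← hinj.tsum_eq, tsum_fintype]
  · refine Finset.sum_congr rfl fun π _ => ?_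
    rw [coeff_C_mul, coeff_X_pow, size, hg, π.parts_sum, if_pos rfl, mul_one]
  · intro s hs
    have hn : n = size s := by
      by_contra hne
      exact hs (show coeff n _ = 0 by rw [coeff_C_mul, coeff_X_pow, if_neg hne, mul_zero])
    refine ⟨⟨parts s, ?_, hn.symm⟩, parts_injective (hg _)⟩
    intro i hi
    obtain ⟨a, -, rfl⟩ := Multiset.mem_map.1 hi
    exact a.succ_pos

/-! ### Removing the largest hook -/

/-- Adds to the Young diagram of `s` a new first row and a new first column, with arm exceeding the
largest part of `s` by `a` and leg exceeding the number of parts of `s` by `b`. -/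
def addHook (x : ℕ × ℕ × Multiset ℕ) : Multiset ℕ :=
  (x.1 + maxPart x.2.2) ::ₘ (Multiset.replicate x.2.1 0 + x.2.2.map (· + 1))

theorem lt_maxPart_of_mem {s : Multiset ℕ} {i : ℕ} (h : i ∈ s) : i < maxPart s :=
  Multiset.le_sup (Multiset.mem_map_of_mem (· + 1) h)

theorem maxPart_le_iff {s : Multiset ℕ} {n : ℕ} : maxPart s ≤ n ↔ ∀ i ∈ s, i < n := by
  simp [maxPart, parts, Multiset.sup_le]

theorem maxPart_addHook (x : ℕ × ℕ × Multiset ℕ) : maxPart (addHook x) = x.1 + maxPart x.2.2 + 1 := by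
  refine le_antisymm (maxPart_le_iff.2 fun i hi => ?_)
    (lt_maxPart_of_mem (Multiset.mem_cons_self _ _))
  simp only [addHook, Multiset.mem_cons, Multiset.mem_add, Multiset.mem_map] at hi
  rcases hi with rfl | hi | ⟨i, hi, rfl⟩
  · omega
  · rw [Multiset.eq_of_mem_replicate hi]; omega
  · have := lt_maxPart_of_mem hi; omega

theorem card_addHook (x : ℕ × ℕ × Multiset ℕ) :
    (addHook x).card = x.2.1 + x.2.2.card + 1 := by
  simp [addHook]

theorem size_addHook (x : ℕ × ℕ × Multiset ℕ) :
    size (addHook x) = x.1 + x.2.1 + 1 + weight 1 1 x.2.2 := by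
  simp only [addHook, size_cons, size_add, size_replicate, size_map_add, weight]; ring

/-- The weight separates over the arm excess, the leg excess and the inner partition, at the cost of
raising both indices: this is what turns hook removal into a recursion. -/
theorem weight_addHook (i j : ℕ) (x : ℕ × ℕ × Multiset ℕ) :
    weight i j (addHook x) = (i + j + 1) +
      ((i + 1) * x.1 + ((j + 1) * x.2.1 + weight (i + 1) (j + 1) x.2.2)) := by
  rw [weight, size_addHook, maxPart_addHook, card_addHook]; simp only [weight]; ring

theorem addHook_injective : Function.Injective addHook := by
  rintro ⟨a, b, s⟩ ⟨a', b', s'⟩ h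
  have hmax_eq := congrArg maxPart h
  rw [maxPart_addHook, maxPart_addHook] at hmax_eq
  simp only [add_left_inj] at hmax_eq
  simp only [addHook, hmax_eq, Multiset.cons_inj_right] at h
  have hcount := congrArg (Multiset.count 0) h
  have h0 (t : Multiset ℕ) : (t.map (· + 1)).count 0 = 0 := by simp
  simp only [Multiset.count_add, Multiset.count_replicate_self, h0, add_zero] at hcount
  subst hcount
  have hs := parts_injective (add_left_cancel h)
  subst hs
  simpa using hmax_eq

theorem exists_addHook_eq {s : Multiset ℕ} (hs : s ≠ 0) : ∃ x, addHook x = s := by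
  obtain ⟨m, hm, hmax⟩ : ∃ m ∈ s, ∀ i ∈ s, i ≤ m := by
    obtain ⟨m, hm, h⟩ := Finset.exists_max_image s.toFinset id
      (Multiset.toFinset_nonempty.2 hs)
    exact ⟨m, Multiset.mem_toFinset.1 hm, fun i hi => h i (Multiset.mem_toFinset.2 hi)⟩
  obtain ⟨t, rfl⟩ := Multiset.exists_cons_of_mem hm
  obtain ⟨u, hu⟩ : ∃ u, parts u = t.filter (0 < ·) :=
    exists_parts_eq fun i hi => (Multiset.mem_filter.1 hi).2
  have hut : maxPart u ≤ m := Multiset.sup_le.2 fun i hi => by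
    rw [hu] at hi
    exact hmax i (Multiset.mem_cons_of_mem (Multiset.mem_of_mem_filter hi))
  refine ⟨(m - maxPart u, t.count 0, u), ?_⟩
  simp only [addHook, Nat.sub_add_cancel hut]
  congr 1
  change _ + parts u = t
  rw [hu, ← Multiset.filter_eq']
  conv_rhs => rw [← Multiset.filter_add_not (· = 0) t]
  simp only [Nat.pos_iff_ne_zero]

theorem tsum_eq_zero_add_tsum_addHook {f : Multiset ℕ → ℤ⟦X⟧} (hf : Summable f) :
    ∑' s, f s = f 0 + ∑' x, f (addHook x) := by
  rw [hf.tsum_eq_add_tsum_ite 0, ← addHook_injective.tsum_eq]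
  · congr 1
    refine tsum_congr fun x => if_neg ?_
    simp [addHook]
  · intro s hs
    refine exists_addHook_eq fun h => hs (by simp [h])

theorem hasSum_mul_mul (i j : ℕ) (f g : ℕ → ℤ⟦X⟧) (h : Multiset ℕ → ℤ⟦X⟧) :
    HasSum (fun x : ℕ × ℕ × Multiset ℕ => f x.1 * X ^ ((i + 1) * x.1) *
      (g x.2.1 * X ^ ((j + 1) * x.2.1) * (h x.2.2 * X ^ weight (i + 1) (j + 1) x.2.2)))
      ((∑' n, f n * X ^ ((i + 1) * n)) * ((∑' n, g n * X ^ ((j + 1) * n)) *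
        ∑' s, h s * X ^ weight (i + 1) (j + 1) s)) := by
  have hi := tendsto_mul_add_one i
  have hj := tendsto_mul_add_one j
  have hw := tendsto_weight (i + 1) (j + 1)
  have h1 := hasSum_mul hj hw (f := fun n => g n * X ^ ((j + 1) * n))
    (g := fun s => h s * X ^ weight (i + 1) (j + 1) s) (fun _ => dvd_mul_left _ _)
    (fun _ => dvd_mul_left _ _)
  have h2 := hasSum_mul hi (tendsto_add_prod hj hw) (f := fun n => f n * X ^ ((i + 1) * n))
    (g := fun x : ℕ × Multiset ℕ =>
      g x.1 * X ^ ((j + 1) * x.1) * (h x.2 * X ^ weight (i + 1) (j + 1) x.2))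
    (fun _ => dvd_mul_left _ _) (fun x => by
      rw [pow_add]
      exact mul_dvd_mul (dvd_mul_left _ _) (dvd_mul_left _ _))
  rwa [h1.tsum_eq] at h2

/-- The generating function of all partitions by `weight i j`. For `i = 0` it is also the generating
function of the partitions into parts larger than `j`. -/
noncomputable def partitionSeries (i j : ℕ) : ℤ⟦X⟧ := ∑' s, X ^ weight i j s

/-- Largest part minus number of parts. -/
def dysonRank (s : Multiset ℕ) : ℤ := maxPart s - s.card

/-- The second moment of the rank, weighted by `weight j j`. -/
noncomputable def rankSqSeries (j : ℕ) : ℤ⟦X⟧ :=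
  ∑' s, (dysonRank s : ℤ⟦X⟧) ^ 2 * X ^ weight j j s

theorem summable_mul_X_pow_weight (i j : ℕ) (f : Multiset ℕ → ℤ⟦X⟧) :
    Summable fun s => f s * X ^ weight i j s :=
  summable_of_X_pow_dvd (tendsto_weight i j) fun _ => dvd_mul_left _ _

/-- A nonempty partition is a hook around a smaller one. -/
theorem partitionSeries_eq (i j : ℕ) :
    partitionSeries i j = 1 + X ^ (i + j + 1) * geom i * geom j *
      partitionSeries (i + 1) (j + 1) := by
  have hs : Summable fun s => (X : ℤ⟦X⟧) ^ weight i j s := by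
    simpa using summable_mul_X_pow_weight i j 1
  have h := (hasSum_mul_mul i j 1 1 1).mul_left (X ^ (i + j + 1))
  simp only [Pi.one_apply, one_mul] at h
  rw [partitionSeries, tsum_eq_zero_add_tsum_addHook hs]
  simp only [weight_addHook, pow_add _ (i + j + 1)]
  simp only [pow_add _ ((i + 1) * _), pow_add _ ((j + 1) * _)]
  rw [h.tsum_eq]
  simp only [weight, size_zero, maxPart_zero, Multiset.card_zero, mul_zero, add_zero, pow_zero,
    partitionSeries, geom]
  ring

theorem dysonRank_addHook (x : ℕ × ℕ × Multiset ℕ) :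
    dysonRank (addHook x) = dysonRank x.2.2 + x.1 - x.2.1 := by
  simp only [dysonRank, maxPart_addHook, card_addHook]; push_cast; ring

/-- Expanding `(r + a - b) ^ 2`, where `r` is the rank of the partition inside the hook: the terms
linear in `r` cancel by the symmetry in `a` and `b`. -/
theorem rankSqSeries_eq (j : ℕ) :
    rankSqSeries j = X ^ (2 * j + 1) * geom j ^ 2 *
      (rankSqSeries (j + 1) + 2 * lambertTerm j * partitionSeries (j + 1) (j + 1)) := by
  set c : ℕ → ℤ⟦X⟧ := fun n => n
  set r : Multiset ℕ → ℤ⟦X⟧ := fun s => (dysonRank s : ℤ⟦X⟧)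
  have h := ((((((hasSum_mul_mul j j 1 1 (r ^ 2)).add (hasSum_mul_mul j j (c ^ 2) 1 1)).add
    (hasSum_mul_mul j j 1 (c ^ 2) 1)).add ((hasSum_mul_mul j j c 1 r).mul_left 2)).sub
    ((hasSum_mul_mul j j 1 c r).mul_left 2)).sub
    ((hasSum_mul_mul j j c c 1).mul_left 2)).mul_left (X ^ (j + j + 1))
  rw [rankSqSeries, tsum_eq_zero_add_tsum_addHook (summable_mul_X_pow_weight j j _)]
  -- `h` holds one summand for each monomial of `(r + a - b) ^ 2`
  refine (congrArg (_ + ·) ((tsum_congr fun x => ?_).trans h.tsum_eq)).trans ?_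
  · simp only [dysonRank_addHook, weight_addHook, pow_add _ (j + j + 1),
      pow_add _ ((j + 1) * _), Pi.one_apply, Pi.pow_apply, c, r]
    push_cast
    ring
  · simp only [Pi.one_apply, Pi.pow_apply, one_mul, c, r, tsum_linear_mul_X_pow,
      tsum_sq_mul_X_pow, ← rankSqSeries.eq_1, ← partitionSeries.eq_1, ← geom.eq_1]
    simp only [dysonRank, maxPart_zero, Multiset.card_zero, lambertTerm]
    push_cast
    ring

/-! ### The generating function of `n * p n` -/

theorem tendsto_id_cofinite : Tendsto (fun n : ℕ => n) cofinite atTop := by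
  rw [Nat.cofinite_eq_atTop]; exact tendsto_id

theorem X_pow_dvd_lambert (c : ℤ⟦X⟧) (k r : ℕ) :
    (X : ℤ⟦X⟧) ^ (k + r) ∣ c * X ^ ((k + 1) * (r + 1)) :=
  (pow_dvd_pow X (by nlinarith [Nat.zero_le (k * r)])).trans (dvd_mul_left _ _)

/-- Both sides are `∑ (r + 1) X ^ ((k + 1) (r + 1))` over all `k` and `r`. -/
theorem tsum_lambert :
    ∑' x : ℕ × ℕ, ((x.1 : ℤ⟦X⟧) + 1) * X ^ ((x.1 + 1) * (x.2 + 1)) = ∑' k, lambertTerm k := by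
  have hw := tendsto_add_prod tendsto_id_cofinite tendsto_id_cofinite
  have hs : Summable fun x : ℕ × ℕ => ((x.2 : ℤ⟦X⟧) + 1) * X ^ ((x.1 + 1) * (x.2 + 1)) :=
    summable_of_X_pow_dvd hw fun x => X_pow_dvd_lambert _ x.1 x.2
  rw [← (Equiv.prodComm ℕ ℕ).tsum_eq]
  simp only [Equiv.prodComm_apply, Prod.fst_swap, Prod.snd_swap]
  simp only [mul_comm (_ + 1 : ℕ) (_ + 1)]
  rw [hs.tsum_prod' fun k => ?_]
  · exact tsum_congr tsum_succ_mul_X_pow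
  · exact summable_of_X_pow_dvd tendsto_id_cofinite fun r =>
      (pow_dvd_pow X (Nat.le_add_left r k)).trans (X_pow_dvd_lambert _ k r)

/-- Inserts `r + 1` parts equal to `k + 1`, keeping track of `k` and `r`. -/
def insertParts (x : (ℕ × ℕ) × Multiset ℕ) : Multiset ℕ × (ℕ × ℕ) :=
  (x.2 + Multiset.replicate (x.1.2 + 1) x.1.1, x.1)

theorem insertParts_injective : Function.Injective insertParts := by
  rintro ⟨x, s⟩ ⟨y, t⟩ h
  simp only [insertParts, Prod.mk.injEq] at h
  obtain ⟨h, rfl⟩ := h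
  rw [add_right_cancel h]

theorem sum_count_eq_size (t : Multiset ℕ) :
    ∑ k ∈ t.toFinset, t.count k * (k + 1) = size t := by
  simpa [size, parts] using (Finset.sum_multiset_map_count t (· + 1)).symm

/-- The generating function of `n * p n`. -/
theorem tsum_size :
    ∑' s, (size s : ℤ⟦X⟧) * X ^ size s = partitionSeries 0 0 * ∑' k, lambertTerm k := by
  have hw := tendsto_add_prod tendsto_id_cofinite tendsto_id_cofinite
  have h := hasSum_mul hw tendsto_size
    (f := fun x : ℕ × ℕ => ((x.1 : ℤ⟦X⟧) + 1) * X ^ ((x.1 + 1) * (x.2 + 1)))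
    (g := fun s => X ^ size s) (fun x => X_pow_dvd_lambert _ x.1 x.2) (fun _ => dvd_rfl)
  -- a partition of size `N` is counted once for each `k` and each `r` below the multiplicity of
  -- `k + 1`, with weight `k + 1`: in all `N` times
  let f : Multiset ℕ × (ℕ × ℕ) → ℤ⟦X⟧ := fun y =>
    if y.2.2 < y.1.count y.2.1 then ((y.2.1 : ℤ⟦X⟧) + 1) * X ^ size y.1 else 0
  have hf : HasSum f ((∑' k, lambertTerm k) * ∑' s, X ^ size s) := by
    rw [← insertParts_injective.hasSum_iff, ← tsum_lambert]
    · have hfg (x : (ℕ × ℕ) × Multiset ℕ) : f (insertParts x) =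
          ((x.1.1 : ℤ⟦X⟧) + 1) * X ^ ((x.1.1 + 1) * (x.1.2 + 1)) * X ^ size x.2 := by
        have hlt : x.1.2 < (x.2 + Multiset.replicate (x.1.2 + 1) x.1.1).count x.1.1 := by
          rw [Multiset.count_add, Multiset.count_replicate_self]; omega
        rw [insertParts, show f _ = _ from if_pos hlt, size_add, size_replicate]
        ring
      rwa [← funext hfg] at h
    · rintro ⟨t, k, r⟩ hx
      refine if_neg fun hlt => hx ?_
      obtain ⟨s, hs⟩ := Multiset.le_iff_exists_add.1 (Multiset.le_count_iff_replicate_le.1 hlt)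
      exact ⟨((k, r), s), Prod.ext ((add_comm _ _).trans hs.symm) rfl⟩
  have hfib (t : Multiset ℕ) : HasSum (fun y => f (t, y)) ((size t : ℤ⟦X⟧) * X ^ size t) := by
    have h1 : HasSum (fun y => f (t, y)) (∑ y ∈ t.toFinset ×ˢ Finset.range t.card, f (t, y)) := by
      refine hasSum_sum_of_ne_finset_zero fun y hy => if_neg fun hlt => hy ?_
      simp only [Finset.mem_product, Multiset.mem_toFinset, Finset.mem_range]
      exact ⟨Multiset.count_pos.1 (Nat.zero_lt_of_lt hlt), hlt.trans_le (Multiset.count_le_card _ _)⟩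
    convert h1 using 1
    have hsize : (size t : ℤ⟦X⟧) = ∑ k ∈ t.toFinset, ((t.count k * (k + 1) : ℕ) : ℤ⟦X⟧) := by
      rw [← Nat.cast_sum, sum_count_eq_size]
    rw [Finset.sum_product, hsize, Finset.sum_mul]
    refine Finset.sum_congr rfl fun k _ => ?_
    have h2 : (Finset.range t.card).filter (· < t.count k) = Finset.range (t.count k) := by
      ext r
      have := Multiset.count_le_card k t
      simp only [Finset.mem_filter, Finset.mem_range]
      omega
    simp only [f]
    rw [← Finset.sum_filter, h2, Finset.sum_const, Finset.card_range, nsmul_eq_mul]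
    push_cast; ring
  rw [(hf.prod_fiberwise hfib).tsum_eq, mul_comm]
  simp [partitionSeries, weight]

/-! ### The generating function of `spt` -/

/-- The multiplicity of the smallest element. -/
noncomputable def minCount (m : Multiset ℕ) : ℕ := m.count (sInf {i | i ∈ m})

/-- The partition with `r + 1` smallest parts `k + 1`, the others being those of `t` increased
by `k + 1`. -/
def insertSmallest (x : ℕ × ℕ × Multiset ℕ) : Multiset ℕ :=
  Multiset.replicate (x.2.1 + 1) x.1 + x.2.2.map (· + (x.1 + 1))

theorem size_insertSmallest (x : ℕ × ℕ × Multiset ℕ) :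
    size (insertSmallest x) = (x.1 + 1) * (x.2.1 + 1) + weight 0 (x.1 + 1) x.2.2 := by
  simp only [insertSmallest, size_add, size_replicate, size_map_add, weight]; ring

theorem isLeast_insertSmallest (x : ℕ × ℕ × Multiset ℕ) :
    IsLeast {i | i ∈ insertSmallest x} x.1 := by
  constructor
  · simp [insertSmallest]
  · intro i hi
    simp only [insertSmallest, Set.mem_ofPred_eq, Multiset.mem_add, Multiset.mem_map] at hi
    rcases hi with hi | ⟨i, -, rfl⟩
    · exact (Multiset.eq_of_mem_replicate hi).ge
    · omega

theorem count_insertSmallest (x : ℕ × ℕ × Multiset ℕ) :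
    (insertSmallest x).count x.1 = x.2.1 + 1 := by
  have h : (x.2.2.map (· + (x.1 + 1))).count x.1 = 0 := by
    rw [Multiset.count_eq_zero, Multiset.mem_map]
    rintro ⟨i, -, hi⟩
    omega
  rw [insertSmallest, Multiset.count_add, Multiset.count_replicate_self, h, add_zero]

theorem minCount_parts_insertSmallest (x : ℕ × ℕ × Multiset ℕ) :
    minCount (parts (insertSmallest x)) = x.2.1 + 1 := by
  have h : IsLeast {i | i ∈ parts (insertSmallest x)} (x.1 + 1) := by
    refine ⟨Multiset.mem_map_of_mem _ (isLeast_insertSmallest x).1, fun i hi => ?_⟩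
    obtain ⟨j, hj, rfl⟩ := Multiset.mem_map.1 hi
    exact Nat.succ_le_succ ((isLeast_insertSmallest x).2 hj)
  rw [minCount, h.csInf_eq, parts, Multiset.count_map_eq_count' _ _ (add_left_injective 1),
    count_insertSmallest]

theorem insertSmallest_injective : Function.Injective insertSmallest := by
  intro x y h
  have h1 := isLeast_insertSmallest x
  rw [h] at h1
  have hk := h1.unique (isLeast_insertSmallest y)
  have h2 := count_insertSmallest x
  rw [h, hk, count_insertSmallest, add_left_inj] at h2
  obtain ⟨k, r, s⟩ := x
  obtain ⟨k', r', t⟩ := y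
  simp only at hk h2
  subst hk h2
  simp only [insertSmallest] at h
  rw [Multiset.map_injective (add_left_injective _) (add_left_cancel h)]

theorem exists_insertSmallest_eq {s : Multiset ℕ} (hs : s ≠ 0) :
    ∃ x, insertSmallest x = s := by
  obtain ⟨m, hm, hmin⟩ : ∃ m ∈ s, ∀ i ∈ s, m ≤ i := by
    obtain ⟨m, hm, h⟩ := Finset.exists_min_image s.toFinset id (Multiset.toFinset_nonempty.2 hs)
    exact ⟨m, Multiset.mem_toFinset.1 hm, fun i hi => h i (Multiset.mem_toFinset.2 hi)⟩
  refine ⟨(m, s.count m - 1, (s.filter (¬ · = m)).map (· - (m + 1))), ?_⟩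
  simp only [insertSmallest, Nat.sub_add_cancel (Multiset.count_pos.2 hm), Multiset.map_map,
    Function.comp_def]
  conv_rhs => rw [← Multiset.filter_add_not (· = m) s, Multiset.filter_eq']
  congr 1
  conv_rhs => rw [← Multiset.map_id (s.filter (¬ · = m))]
  refine Multiset.map_congr rfl fun i hi => ?_
  obtain ⟨hi, hne⟩ := Multiset.mem_filter.1 hi
  have := hmin i hi
  simp only [id]
  omega

/-- The generating function of `spt`. -/
theorem tsum_minCount :
    ∑' s, (minCount (parts s) : ℤ⟦X⟧) * X ^ size s =
      ∑' k, lambertTerm k * partitionSeries 0 (k + 1) := by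
  rw [← insertSmallest_injective.tsum_eq]
  · have hterm (x : ℕ × ℕ × Multiset ℕ) :
        (minCount (parts (insertSmallest x)) : ℤ⟦X⟧) * X ^ size (insertSmallest x) =
          ((x.2.1 : ℤ⟦X⟧) + 1) * X ^ ((x.1 + 1) * (x.2.1 + 1)) * X ^ weight 0 (x.1 + 1) x.2.2 := by
      rw [minCount_parts_insertSmallest, size_insertSmallest, pow_add]
      push_cast; ring
    have hw := tendsto_add_prod tendsto_id_cofinite
      (tendsto_add_prod tendsto_id_cofinite tendsto_size)
    let f : ℕ × ℕ × Multiset ℕ → ℤ⟦X⟧ := fun x =>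
      ((x.2.1 : ℤ⟦X⟧) + 1) * X ^ ((x.1 + 1) * (x.2.1 + 1)) * X ^ weight 0 (x.1 + 1) x.2.2
    have hf : Summable f := by
      refine summable_of_X_pow_dvd hw fun x => ?_
      have h1 := X_pow_dvd_lambert ((x.2.1 : ℤ⟦X⟧) + 1) x.1 x.2.1
      have h2 : (X : ℤ⟦X⟧) ^ size x.2.2 ∣ X ^ weight 0 (x.1 + 1) x.2.2 :=
        pow_dvd_pow X (by unfold weight; omega)
      have h3 := mul_dvd_mul h1 h2
      rwa [← pow_add, add_assoc] at h3
    have hfib (k : ℕ) : HasSum (fun y => f (k, y)) (lambertTerm k * partitionSeries 0 (k + 1)) := by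
      have h := hasSum_mul tendsto_id_cofinite (tendsto_weight 0 (k + 1))
        (f := fun r : ℕ => ((r : ℤ⟦X⟧) + 1) * X ^ ((k + 1) * (r + 1)))
        (g := fun s => X ^ weight 0 (k + 1) s)
        (fun r => (pow_dvd_pow X (Nat.le_add_left r k)).trans (X_pow_dvd_lambert _ k r))
        (fun _ => dvd_rfl)
      rwa [tsum_succ_mul_X_pow] at h
    rw [tsum_congr hterm]
    exact (hf.hasSum.prod_fiberwise hfib).tsum_eq.symm
  · intro s hs
    refine exists_insertSmallest_eq fun h => hs ?_
    simp [h, minCount]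

/-! ### Comparison by successive removal of hooks -/

theorem tsum_lambertTerm_succ (n : ℕ) :
    ∑' k, lambertTerm (n + k) = lambertTerm n + ∑' k, lambertTerm (n + 1 + k) := by
  rw [(summable_lambertTerm n).tsum_eq_zero_add, add_zero]
  simp only [add_assoc, add_comm 1]

theorem summable_durfeeTerm_mul (n : ℕ) (f : ℕ → ℤ⟦X⟧) :
    Summable fun k => durfeeTerm k n * f k :=
  summable_of_X_pow_dvd (tendsto_add_right 1) fun k => (X_pow_dvd_durfeeTerm k n).mul_right _

/-- Hook removal applied to each `partitionSeries n (n + k + 1)`; the terms free of a partition series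
are summed by `tsum_durfeeTerm`. -/
theorem tsum_durfeeTerm_mul_partitionSeries (n : ℕ) :
    ∑' k, durfeeTerm k n * partitionSeries n (n + k + 1) =
      ∑' k, lambertTerm (n + k) + X ^ (2 * n + 1) * geom n ^ 2 *
        ∑' k, durfeeTerm k (n + 1) * partitionSeries (n + 1) (n + 1 + k + 1) := by
  rw [← tsum_durfeeTerm, ← (summable_durfeeTerm_mul (n + 1) _).tsum_mul_left,
    ← (summable_durfeeTerm n).tsum_add ((summable_durfeeTerm_mul (n + 1) _).mul_left _)]
  refine tsum_congr fun k => ?_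
  rw [partitionSeries_eq n, durfeeTerm, show n + 1 + k + 1 = n + k + 1 + 1 by omega]
  have h := geom_mul n
  linear_combination (-X ^ (2 * n + k + 2) * geom n * durfeeTerm k n * geom (n + k + 1) *
    partitionSeries (n + 1) (n + k + 1 + 1)) * h

/-- The difference of the two sides at stage `n` equals `X ^ (2 n + 1) / (1 - X ^ (n + 1)) ^ 2` times
the difference at stage `n + 1`, so it is divisible by every power of `X`. -/
theorem two_mul_tsum_durfeeTerm (n : ℕ) :
    2 * ∑' k, durfeeTerm k n * partitionSeries n (n + k + 1) -
      (2 * (partitionSeries n n * ∑' k, lambertTerm (n + k)) - rankSqSeries n) = 0 := by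
  refine eq_zero_of_eq_mul_succ (u := fun n =>
    2 * ∑' k, durfeeTerm k n * partitionSeries n (n + k + 1) -
      (2 * (partitionSeries n n * ∑' k, lambertTerm (n + k)) - rankSqSeries n))
    (c := fun n => X ^ (2 * n + 1) * geom n ^ 2) (fun n => ?_) (fun n => ?_) n
  · exact (dvd_pow_self X (by omega)).mul_right _
  · rw [tsum_durfeeTerm_mul_partitionSeries, partitionSeries_eq n n, rankSqSeries_eq,
      tsum_lambertTerm_succ]
    ring

theorem two_mul_tsum_minCount :
    2 * ∑' s, (minCount (parts s) : ℤ⟦X⟧) * X ^ size s =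
      2 * ∑' s, (size s : ℤ⟦X⟧) * X ^ size s - rankSqSeries 0 := by
  have h := two_mul_tsum_durfeeTerm 0
  simp only [durfeeTerm, zero_add] at h
  rw [tsum_minCount, tsum_size]
  linear_combination h

/-! ### Passing to coefficients -/

theorem rankMoment_two (n : ℕ) : rankMoment 2 n = ∑ π : n.Partition, rank π ^ 2 := by
  rw [rankMoment, finsum_eq_sum_of_support_subset (s := Finset.univ.image
    fun π : n.Partition => rank π), Finset.sum_comp (fun m : ℤ => m ^ 2)]
  · refine Finset.sum_congr rfl fun m _ => ?_
    rw [N, Fintype.card_subtype, nsmul_eq_mul, mul_comm]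
  · intro m hm
    have h : N m n ≠ 0 := fun h0 => hm (by simp [h0])
    obtain ⟨π, hπ⟩ := Fintype.card_pos_iff.mp (Nat.pos_of_ne_zero h)
    simpa using ⟨π, hπ⟩

theorem two_mul_spt (n : ℕ) : 2 * (spt n : ℤ) = 2 * (n * p n) - rankMoment 2 n := by
  have h := congrArg (coeff n) two_mul_tsum_minCount
  have e1 := coeff_tsum_parts (fun m => minCount m) n
  have e2 := coeff_tsum_parts (fun m => m.sum) n
  have e3 := coeff_tsum_parts (fun m => ((m.sup : ℤ) - m.card) ^ 2) n
  have hr : rankSqSeries 0 =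
      ∑' s, (C ((((parts s).sup : ℤ) - (parts s).card) ^ 2) : ℤ⟦X⟧) * X ^ size s := by
    refine tsum_congr fun s => ?_
    simp [dysonRank, weight, maxPart, parts]
  have h2 (f : ℤ⟦X⟧) : coeff n (2 * f) = 2 * coeff n f := by
    rw [show (2 : ℤ⟦X⟧) = C 2 by simp, coeff_C_mul]
  rw [map_sub, h2, h2, hr, e3] at h
  simp only [eq_intCast, Int.cast_natCast] at e1 e2
  simp only [size] at h e1 e2
  rw [e1, e2] at h
  simp only [Nat.Partition.parts_sum, Finset.sum_const, Finset.card_univ, nsmul_eq_mul] at h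
  rw [rankMoment_two, spt, p, Nat.cast_sum]
  simp only [rank, largestPart, smallestPart]
  simp only [minCount] at h
  linear_combination h

end SptRank

theorem corollary2p9 (n : ℕ) :
    (SptRank.spt n : ℚ) =
      (n : ℚ) * (SptRank.p n : ℚ) - (1 / 2 : ℚ) * (SptRank.rankMoment 2 n : ℚ) := by
  have h : ((2 * (SptRank.spt n : ℤ) : ℤ) : ℚ) = _ := congrArg _ (SptRank.two_mul_spt n)
  push_cast at h
  linear_combination h / 2
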